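/- Let $n\in\mathbb{N}$ and let $J=\begin{pmatrix}0&\mathbb{1}_n\\-\mathbb{1}_n&0\end{pmatrix}$. Let $Sp(2n)=\{S\in\mathbb{R}^{2n\times 2n}\mid S^TJS=J\}$ be the real symplectic group, and for $A\in\mathbb{R}^{2n\times 2n}$ with singular values $s_1(A)\ge s_2(A)\ge\dots\ge s_{2n}(A)$ put $F(A)=\sum_{i=1}^n\log s_i(A)$ (the sum over the $n$ largest singular values). For $\Gamma\in\mathbb{R}^{2n\times 2n}$ define the squeezing measure $$G(\Gamma)=\inf\{F(S)\mid S\in Sp(2n),\ \Gamma\ge S^TS\},$$ where $\ge$ is the positive semidefinite order on Hermitian matrices. Then on the set of covariance matrices $$\{\Gamma\in\mathbb{R}^{2n\times 2n}\mid \Gamma\ge iJ\}$$ (real matrices $\Gamma$ such that $\Gamma-iJ$ is Hermitian and positive semidefinite) the infimum defining $G$ is finite, i.e. it is the infimum of a nonempty set of reals that is bounded below, and $G$ is convex: the set is convex, and for all $\Gamma,\Gamma'$ in it and all $t\in[0,1]$, $$G(t\Gamma+(1-t)\Gamma')\le t\,G(\Gamma)+(1-t)\,G(\Gamma').$$ 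-/

import Mathlib

open Matrix
open scoped ComplexOrder

namespace Squeezing

noncomputable section

/-- Real `2n × 2n` matrices, in the basis `(Q₁, …, Qₙ, P₁, …, Pₙ)`. -/
abbrev Mat (n : ℕ) : Type := Matrix (Fin n ⊕ Fin n) (Fin n ⊕ Fin n) ℝ

/-- The symplectic form `J = (0, 1; -1, 0)`. (Mathlib's `Matrix.J` is its negative.) -/
def symplecticForm (n : ℕ) : Mat n := Matrix.fromBlocks 0 1 (-1) 0

/-- Mathlib's symplectic group is `Sp(2n) = {S | Sᵀ J S = J}` for this `J`. -/
theorem mem_symplecticGroup_iff {n : ℕ} (S : Mat n) :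
    S ∈ Matrix.symplecticGroup (Fin n) ℝ ↔ Sᵀ * symplecticForm n * S = symplecticForm n := by
  have h : symplecticForm n = -Matrix.J (Fin n) ℝ := by
    simp [symplecticForm, Matrix.J, Matrix.fromBlocks_neg]
  rw [SymplecticGroup.mem_iff', h, Matrix.mul_neg, Matrix.neg_mul, neg_inj]

/-- The covariance matrices: the real matrices `Γ` with `Γ ≥ iJ`, that is, such that the complex
matrix `Γ - iJ` is (Hermitian and) positive semidefinite. -/
def covarianceMatrices (n : ℕ) : Set (Mat n) :=
  {Γ | (Γ.map Complex.ofReal - Complex.I • (symplecticForm n).map Complex.ofReal).PosSemidef}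

/-- `F(A) = ∑_{i=1}^n log sᵢ(A)`, where `s₁(A) ≥ … ≥ s₂ₙ(A)` are the singular values of the
`2n × 2n` matrix `A`: the sum runs over the `n` largest ones.
(`LinearMap.singularValues` is decreasing and indexed from `0`.) -/
def F {n : ℕ} (A : Mat n) : ℝ :=
  ∑ i ∈ Finset.range n, Real.log ((Matrix.toEuclideanLin A).singularValues i)

/-- The set `{F(S) | Γ ≥ SᵀS, S ∈ Sp(2n)}`. -/
def costs {n : ℕ} (Γ : Mat n) : Set ℝ :=
  {x | ∃ S ∈ Matrix.symplecticGroup (Fin n) ℝ, (Γ - Sᵀ * S).PosSemidef ∧ F S = x}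

/-- The squeezing measure `G(Γ) = inf {F(S) | Γ ≥ SᵀS, S ∈ Sp(2n)}`. -/
def G {n : ℕ} (Γ : Mat n) : ℝ := sInf (costs Γ)

end

end Squeezing

/-! Write P = SᵀS. Conjugation by J sends P to P⁻¹, so the spectrum of P is closed under inversion
and F(S) = ¼ tr |log P|; in particular F ≥ 0 on the symplectic group. The map P ↦ M = (P + 1)⁻¹
takes the positive definite symplectic matrices onto the positive definite solutions of JM + MJ = J.
This condition is affine, so such M can be averaged. In this coordinate F = ¼ tr φ(M) with φ(x) =
|log((1 - x)/x)|, which is convex on (0,1); Peierls' inequality turns this into convexity of the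
trace (`sum_convexOn_eigenvalues_le`). Inversion is operator convex, so the averaged M satisfies M⁻¹
- 1 ≤ aP + bP' ≤ aΓ + bΓ' and yields an admissible competitor (`exists_mem_costs_le`). Admissible S
exist because Γ ≥ iJ makes B = Γ^(-1/2) J Γ^(-1/2) a contraction: then Γ^(1/2) |B| Γ^(1/2) is
symplectic and lies below Γ. -/

namespace Squeezing

/-! ### Trace inequalities via orthonormal eigenbases -/

section Eigenbasis

variable {E ι κ : Type*} [NormedAddCommGroup E] [InnerProductSpace ℝ E] [Fintype ι] [Fintype κ]

/-- The squared coefficients of a vector in an orthonormal basis sum to the squared norm. -/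
theorem sum_sq_inner_eq_one (b : OrthonormalBasis ι ℝ E) {x : E} (hx : ‖x‖ = 1) :
    ∑ j, inner ℝ (b j) x ^ 2 = 1 := by
  have := b.sum_sq_norm_inner_right x
  simpa [hx] using this

theorem inner_map_self_eq_sum (b : OrthonormalBasis ι ℝ E) {A : E →ₗ[ℝ] E} {a : ι → ℝ}
    (hA : ∀ j, A (b j) = a j • b j) (x : E) :
    inner ℝ x (A x) = ∑ j, inner ℝ (b j) x ^ 2 * a j := by
  conv_lhs => rw [← b.sum_repr' x, map_sum, inner_sum]
  refine Finset.sum_congr rfl fun j _ => ?_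
  rw [b.sum_repr' x, map_smul, hA, inner_smul_right, inner_smul_right, real_inner_comm]
  ring

theorem inner_map_self_mem (b : OrthonormalBasis ι ℝ E) {A : E →ₗ[ℝ] E} {a : ι → ℝ}
    (hA : ∀ j, A (b j) = a j • b j) {s : Set ℝ} (hs : Convex ℝ s) (has : ∀ j, a j ∈ s)
    {x : E} (hx : ‖x‖ = 1) : inner ℝ x (A x) ∈ s := by
  rw [inner_map_self_eq_sum b hA]
  exact hs.sum_mem (fun _ _ => sq_nonneg _) (sum_sq_inner_eq_one b hx) fun j _ => has j

/-- Peierls' inequality: a convex function of the diagonal entries of a symmetric operator in any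
orthonormal basis sums to at most the sum over the eigenvalues. -/
theorem sum_convexOn_inner_le (b : OrthonormalBasis ι ℝ E) (u : OrthonormalBasis κ ℝ E)
    {A : E →ₗ[ℝ] E} {a : ι → ℝ} (hA : ∀ j, A (b j) = a j • b j) {s : Set ℝ} {φ : ℝ → ℝ}
    (hφ : ConvexOn ℝ s φ) (has : ∀ j, a j ∈ s) :
    ∑ i, φ (inner ℝ (u i) (A (u i))) ≤ ∑ j, φ (a j) := by
  calc ∑ i, φ (inner ℝ (u i) (A (u i)))
      ≤ ∑ i, ∑ j, inner ℝ (b j) (u i) ^ 2 * φ (a j) := by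
        refine Finset.sum_le_sum fun i _ => ?_
        rw [inner_map_self_eq_sum b hA]
        exact hφ.map_sum_le (fun _ _ => sq_nonneg _) (sum_sq_inner_eq_one b (u.norm_eq_one i))
          fun j _ => has j
    _ = ∑ j, φ (a j) := by
        -- The squared overlaps are doubly stochastic: they also sum to 1 over i, since b j is a
        -- unit vector.
        rw [Finset.sum_comm]
        refine Finset.sum_congr rfl fun j _ => ?_
        rw [← Finset.sum_mul]
        simp_rw [real_inner_comm _ (b j)]
        rw [sum_sq_inner_eq_one u (b.norm_eq_one j), one_mul]

/-- Convexity of `A ↦ tr φ(A)` for convex `φ`, in terms of orthonormal eigenbases. -/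
theorem sum_convexOn_eigenvalues_le {ι₁ ι₂ : Type*} [Fintype ι₁] [Fintype ι₂]
    (b₁ : OrthonormalBasis ι₁ ℝ E) (b₂ : OrthonormalBasis ι₂ ℝ E) (u : OrthonormalBasis κ ℝ E)
    {A₁ A₂ : E →ₗ[ℝ] E} {a₁ : ι₁ → ℝ} {a₂ : ι₂ → ℝ} {m : κ → ℝ} {t₁ t₂ : ℝ}
    (hA₁ : ∀ j, A₁ (b₁ j) = a₁ j • b₁ j) (hA₂ : ∀ j, A₂ (b₂ j) = a₂ j • b₂ j)
    (hM : ∀ i, (t₁ • A₁ + t₂ • A₂) (u i) = m i • u i) (ht₁ : 0 ≤ t₁) (ht₂ : 0 ≤ t₂)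
    (ht : t₁ + t₂ = 1) {s : Set ℝ} {φ : ℝ → ℝ} (hφ : ConvexOn ℝ s φ)
    (h₁ : ∀ j, a₁ j ∈ s) (h₂ : ∀ j, a₂ j ∈ s) :
    ∑ i, φ (m i) ≤ t₁ * ∑ j, φ (a₁ j) + t₂ * ∑ j, φ (a₂ j) := by
  have hm (i) : m i = t₁ * inner ℝ (u i) (A₁ (u i)) + t₂ * inner ℝ (u i) (A₂ (u i)) := by
    have := congrArg (inner ℝ (u i)) (hM i)
    simpa [inner_add_right, inner_smul_right, eq_comm] using this
  calc ∑ i, φ (m i)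
      ≤ ∑ i, (t₁ * φ (inner ℝ (u i) (A₁ (u i))) + t₂ * φ (inner ℝ (u i) (A₂ (u i)))) := by
        refine Finset.sum_le_sum fun i _ => ?_
        rw [hm]
        exact hφ.2 (inner_map_self_mem b₁ hA₁ hφ.1 h₁ (u.norm_eq_one i))
          (inner_map_self_mem b₂ hA₂ hφ.1 h₂ (u.norm_eq_one i)) ht₁ ht₂ ht
    _ ≤ _ := by
        rw [Finset.sum_add_distrib, ← Finset.mul_sum, ← Finset.mul_sum]
        exact add_le_add (mul_le_mul_of_nonneg_left (sum_convexOn_inner_le b₁ u hA₁ hφ h₁) ht₁)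
          (mul_le_mul_of_nonneg_left (sum_convexOn_inner_le b₂ u hA₂ hφ h₂) ht₂)

/-- Sums over the eigenvalues do not depend on the orthonormal eigenbasis. -/
theorem sum_eigenvalues_eq (b : OrthonormalBasis ι ℝ E) (u : OrthonormalBasis κ ℝ E)
    {A : E →ₗ[ℝ] E} {a : ι → ℝ} {m : κ → ℝ} (hA : ∀ j, A (b j) = a j • b j)
    (hm : ∀ i, A (u i) = m i • u i) (φ : ℝ → ℝ) : ∑ i, φ (m i) = ∑ j, φ (a j) := by
  classical
  -- Eigenvectors that are not orthogonal share their eigenvalue.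
  have key (i j) : inner ℝ (b j) (u i) ^ 2 * φ (m i) = inner ℝ (b j) (u i) ^ 2 * φ (a j) := by
    have h1 : inner ℝ (b j) (A (u i)) = a j * inner ℝ (b j) (u i) := by
      conv_lhs => rw [← b.sum_repr' (u i), map_sum, inner_sum]
      simp_rw [map_smul, hA, inner_smul_right, b.inner_eq_ite]
      simp [mul_comm]
    rw [hm, inner_smul_right] at h1
    rcases eq_or_ne (inner ℝ (b j) (u i)) 0 with h | h
    · simp [h]
    · rw [mul_right_cancel₀ h h1]
  calc ∑ i, φ (m i) = ∑ i, ∑ j, inner ℝ (b j) (u i) ^ 2 * φ (m i) := by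
        refine Finset.sum_congr rfl fun i _ => ?_
        rw [← Finset.sum_mul, sum_sq_inner_eq_one b (u.norm_eq_one i), one_mul]
    _ = ∑ j, φ (a j) := by
        simp_rw [key]
        rw [Finset.sum_comm]
        refine Finset.sum_congr rfl fun j _ => ?_
        rw [← Finset.sum_mul]
        simp_rw [real_inner_comm _ (b j)]
        rw [sum_sq_inner_eq_one u (b.norm_eq_one j), one_mul]

end Eigenbasis

/-! ### The scalar function |log((1 - x)/x)| and inversion-invariant spectra -/

section Scalar

/-- This is 2 artanh u, whose derivative 2/(1 - u²) increases on (0,1). -/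
theorem convexOn_log_sub_log :
    ConvexOn ℝ (Set.Ico (0 : ℝ) 1) fun u => Real.log (1 + u) - Real.log (1 - u) := by
  have hd : ∀ u ∈ Set.Ioo (0 : ℝ) 1, HasDerivAt (fun u => Real.log (1 + u) - Real.log (1 - u))
      (1 / (1 + u) - (-1) / (1 - u)) u := fun u hu =>
    (((hasDerivAt_id' u).const_add 1).log (by linarith [hu.1])).sub
      (((hasDerivAt_id' u).const_sub 1).log (by linarith [hu.2]))
  refine MonotoneOn.convexOn_of_deriv (convex_Ico 0 1) ?_ ?_ ?_
  · refine ContinuousOn.sub (ContinuousOn.log (by fun_prop) ?_) (ContinuousOn.log (by fun_prop) ?_)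
    · intro u hu; linarith [hu.1]
    · intro u hu; linarith [hu.2]
  · rw [interior_Ico]
    exact fun u hu => (hd u hu).differentiableAt.differentiableWithinAt
  · rw [interior_Ico]
    intro u hu v hv huv
    rw [(hd u hu).deriv, (hd v hv).deriv]
    have e (w : ℝ) (hw : w ∈ Set.Ioo (0 : ℝ) 1) :
        1 / (1 + w) - (-1) / (1 - w) = 2 / (1 - w ^ 2) := by
      have h1 : 1 + w ≠ 0 := by linarith [hw.1]
      have h2 : 1 - w ≠ 0 := by linarith [hw.2]
      have h3 : 1 - w ^ 2 ≠ 0 := by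
        rw [show 1 - w ^ 2 = (1 + w) * (1 - w) by ring]; exact mul_ne_zero h1 h2
      field_simp
      ring
    rw [e u hu, e v hv]
    have : 0 < 1 - v ^ 2 := by nlinarith [hv.1, hv.2]
    have : u ^ 2 ≤ v ^ 2 := by nlinarith [hu.1]
    gcongr

theorem monotoneOn_log_sub_log :
    MonotoneOn (fun u => Real.log (1 + u) - Real.log (1 - u)) (Set.Ico (0 : ℝ) 1) := by
  intro u hu v hv huv
  have := Real.log_le_log (by linarith [hu.1] : 0 < 1 + u) (by linarith : 1 + u ≤ 1 + v)
  have := Real.log_le_log (by linarith [hv.2] : 0 < 1 - v) (by linarith : 1 - v ≤ 1 - u)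
  simp only
  linarith

theorem abs_log_sub_log_eq {x : ℝ} (hx : x ∈ Set.Ioo (0 : ℝ) 1) :
    |Real.log (1 - x) - Real.log x| =
      Real.log (1 + |1 - 2 * x|) - Real.log (1 - |1 - 2 * x|) := by
  obtain ⟨h0, h1⟩ := hx
  rcases le_total x (1 / 2) with h | h
  · have := Real.log_le_log h0 (by linarith : x ≤ 1 - x)
    rw [abs_of_nonneg (by linarith : 0 ≤ 1 - 2 * x), abs_of_nonneg (by linarith),
      show 1 + (1 - 2 * x) = 2 * (1 - x) by ring, show 1 - (1 - 2 * x) = 2 * x by ring,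
      Real.log_mul (by norm_num) (by linarith), Real.log_mul (by norm_num) h0.ne']
    ring
  · have := Real.log_le_log (by linarith) (by linarith : 1 - x ≤ x)
    rw [abs_of_nonpos (by linarith : 1 - 2 * x ≤ 0), abs_of_nonpos (by linarith),
      show 1 + -(1 - 2 * x) = 2 * x by ring, show 1 - -(1 - 2 * x) = 2 * (1 - x) by ring,
      Real.log_mul (by norm_num) h0.ne', Real.log_mul (by norm_num) (by linarith)]
    ring

/-- Without the absolute value, convexity fails for x > 1/2. With it, the function is the increasing
convex 2 artanh composed with the convex |1 - 2x|. -/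
theorem convexOn_abs_log_sub_log :
    ConvexOn ℝ (Set.Ioo (0 : ℝ) 1) fun x => |Real.log (1 - x) - Real.log x| := by
  refine ⟨convex_Ioo 0 1, fun x hx y hy a b ha hb hab => ?_⟩
  have hmem {z : ℝ} (hz : z ∈ Set.Ioo (0 : ℝ) 1) : |1 - 2 * z| ∈ Set.Ico (0 : ℝ) 1 :=
    ⟨abs_nonneg _, abs_lt.2 ⟨by linarith [hz.2], by linarith [hz.1]⟩⟩
  have hxy := convex_Ioo (0 : ℝ) 1 hx hy ha hb hab
  simp only
  rw [abs_log_sub_log_eq hx, abs_log_sub_log_eq hy, abs_log_sub_log_eq hxy]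
  have hle : |1 - 2 * (a • x + b • y)| ≤ a • |1 - 2 * x| + b • |1 - 2 * y| := by
    have : 1 - 2 * (a • x + b • y) = a * (1 - 2 * x) + b * (1 - 2 * y) := by
      simp only [smul_eq_mul]; linear_combination -hab
    rw [this]
    refine (abs_add_le _ _).trans ?_
    rw [abs_mul, abs_mul, abs_of_nonneg ha, abs_of_nonneg hb]
    rfl
  exact (monotoneOn_log_sub_log (hmem hxy)
    (convex_Ico (0 : ℝ) 1 (hmem hx) (hmem hy) ha hb hab) hle).trans
    (convexOn_log_sub_log.2 (hmem hx) (hmem hy) ha hb hab)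

theorem abs_log_sub_log_inv_add_one {l : ℝ} (hl : 0 < l) :
    |Real.log (1 - (l + 1)⁻¹) - Real.log (l + 1)⁻¹| = |Real.log l| := by
  have : 1 - (l + 1)⁻¹ = l * (l + 1)⁻¹ := by field_simp; ring
  rw [this, Real.log_mul hl.ne' (by positivity)]
  ring_nf

theorem inv_add_one_mem_Ioo {l : ℝ} (hl : 0 < l) : (l + 1)⁻¹ ∈ Set.Ioo (0 : ℝ) 1 :=
  ⟨by positivity, inv_lt_one_of_one_lt₀ (by linarith)⟩

/-- For a decreasing positive family of `2n` numbers that is invariant under inversion, the `n`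
largest ones carry half of the total `∑ |log|`. -/
theorem sum_log_castAdd_eq {n : ℕ} {l : Fin (n + n) → ℝ} (hanti : Antitone l)
    (hl : ∀ i, 0 < l i) (hinv : ∀ φ : ℝ → ℝ, ∑ i, φ (l i)⁻¹ = ∑ i, φ (l i)) :
    ∑ i : Fin n, Real.log (l (Fin.castAdd n i)) = 2⁻¹ * ∑ i, |Real.log (l i)| := by
  -- Invariance for the indicator of x < 1: as many entries exceed 1 as lie below 1, hence at most n
  -- of each.
  have hcard : (Finset.univ.filter fun i => 1 < l i).card =
      (Finset.univ.filter fun i => l i < 1).card := by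
    have := hinv fun x => if x < 1 then 1 else 0
    simp only [Finset.sum_boole] at this
    rw [← Nat.cast_inj (R := ℝ), ← this]
    congr 2
    ext i
    simp [inv_lt_one_iff₀, (hl i).not_ge]
  have hdisj : (Finset.univ.filter fun i => 1 < l i).card +
      (Finset.univ.filter fun i => l i < 1).card ≤ n + n := by
    rw [← Finset.card_union_of_disjoint]
    · exact (Finset.card_le_univ _).trans_eq (Fintype.card_fin _)
    · rw [Finset.disjoint_filter]; intro i _ h1 h2; linarith
  -- Otherwise this entry and all later ones, at least n + 1 in number, would lie below 1.
  have hlow (i : Fin n) : 1 ≤ l (Fin.castAdd n i) := by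
    by_contra! h
    have hsub : Finset.Ici (Fin.castAdd n i) ⊆ Finset.univ.filter fun i => l i < 1 := by
      intro j hj
      rw [Finset.mem_Ici] at hj
      simpa using (hanti hj).trans_lt h
    have := Finset.card_le_card hsub
    rw [Fin.card_Ici] at this
    have := i.2
    simp at *
    omega
  have hhigh (i : Fin n) : l (Fin.natAdd n i) ≤ 1 := by
    by_contra! h
    have hsub : Finset.Iic (Fin.natAdd n i) ⊆ Finset.univ.filter fun i => 1 < l i := by
      intro j hj
      rw [Finset.mem_Iic] at hj
      simpa using h.trans_le (hanti hj)
    have := Finset.card_le_card hsub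
    rw [Fin.card_Iic] at this
    simp at *
    omega
  have hsum : ∑ i, Real.log (l i) = 0 := by
    have := hinv Real.log
    simp only [Real.log_inv, Finset.sum_neg_distrib] at this
    linarith
  rw [Fin.sum_univ_add] at hsum
  rw [Fin.sum_univ_add]
  have e1 : ∑ i : Fin n, |Real.log (l (Fin.castAdd n i))| =
      ∑ i : Fin n, Real.log (l (Fin.castAdd n i)) :=
    Finset.sum_congr rfl fun i _ => abs_of_nonneg (Real.log_nonneg (hlow i))
  have e2 : ∑ i : Fin n, |Real.log (l (Fin.natAdd n i))| =
      -∑ i : Fin n, Real.log (l (Fin.natAdd n i)) := by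
    rw [← Finset.sum_neg_distrib]
    exact Finset.sum_congr rfl fun i _ => abs_of_nonpos (Real.log_nonpos (hl _).le (hhigh i))
  rw [e1, e2]
  linarith

end Scalar

/-! ### Symplectic matrices and their square roots -/

section SymplecticForm

variable {n : ℕ}

theorem symplecticForm_transpose : (symplecticForm n)ᵀ = -symplecticForm n := by
  simp [symplecticForm, fromBlocks_transpose, fromBlocks_neg]

theorem symplecticForm_mul_self : symplecticForm n * symplecticForm n = -1 := by
  simp [symplecticForm, fromBlocks_multiply, ← fromBlocks_one, fromBlocks_neg]

theorem symplecticForm_transpose_mul_self : (symplecticForm n)ᵀ * symplecticForm n = 1 := by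
  simp [symplecticForm_transpose, symplecticForm_mul_self]

theorem symplecticForm_mul_transpose_self : symplecticForm n * (symplecticForm n)ᵀ = 1 := by
  simp [symplecticForm_transpose, symplecticForm_mul_self]

theorem isUnit_of_mul_symplecticForm_mul {P : Mat n}
    (h : P * symplecticForm n * P = symplecticForm n) : IsUnit P := by
  refine IsUnit.of_mul_eq_one (symplecticForm n * P * (symplecticForm n)ᵀ) ?_
  rw [← Matrix.mul_assoc, ← Matrix.mul_assoc, h, symplecticForm_mul_transpose_self]

/-- `SᵀS` is symplectic for symplectic `S`. -/
theorem transpose_mul_self_mul_symplecticForm_mul {S : Mat n}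
    (hS : S ∈ symplecticGroup (Fin n) ℝ) :
    Sᵀ * S * symplecticForm n * (Sᵀ * S) = symplecticForm n := by
  have h1 := (mem_symplecticGroup_iff S).1 hS
  have h2 := (mem_symplecticGroup_iff Sᵀ).1 (SymplecticGroup.transpose_mem hS)
  rw [transpose_transpose] at h2
  calc Sᵀ * S * symplecticForm n * (Sᵀ * S) = Sᵀ * (S * symplecticForm n * Sᵀ) * S := by
        noncomm_ring
    _ = symplecticForm n := by rw [h2, h1]

theorem posDef_transpose_mul_self {S : Mat n} (hS : S ∈ symplecticGroup (Fin n) ℝ) :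
    (Sᵀ * S).PosDef :=
  (posSemidef_conjTranspose_mul_self S).posDef_iff_isUnit.2
    (isUnit_of_mul_symplecticForm_mul (transpose_mul_self_mul_symplecticForm_mul hS))

open scoped MatrixOrder in
/-- Every positive semidefinite symplectic matrix is `SᵀS` for a symplectic `S`, namely its
square root. -/
theorem exists_symplectic_transpose_mul_self {P : Mat n} (hP : P.PosSemidef)
    (hJ : P * symplecticForm n * P = symplecticForm n) :
    ∃ S ∈ symplecticGroup (Fin n) ℝ, Sᵀ * S = P := by
  have hS : (CFC.sqrt P).PosSemidef := (CFC.sqrt_nonneg P).posSemidef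
  have hSS : CFC.sqrt P * CFC.sqrt P = P := CFC.sqrt_mul_sqrt_self P hP.nonneg
  have hinv : P⁻¹ = (symplecticForm n)ᵀ * P * symplecticForm n := by
    refine inv_eq_left_inv ?_
    rw [Matrix.mul_assoc, Matrix.mul_assoc, ← Matrix.mul_assoc P, hJ,
      symplecticForm_transpose_mul_self]
  have hunit : IsUnit (CFC.sqrt P) := by
    have := isUnit_of_mul_symplecticForm_mul hJ
    rw [← hSS] at this
    exact isUnit_of_mul_isUnit_left this
  -- Both sides are positive semidefinite square roots of P⁻¹ = JᵀPJ, and such a root is unique.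
  have hconj : (CFC.sqrt P)⁻¹ = (symplecticForm n)ᵀ * CFC.sqrt P * symplecticForm n := by
    rw [hP.inv_sqrt]
    refine CFC.sqrt_unique ?_ (hS.conjTranspose_mul_mul_same (symplecticForm n)).nonneg
    rw [hinv]
    calc (symplecticForm n)ᵀ * CFC.sqrt P * symplecticForm n *
          ((symplecticForm n)ᵀ * CFC.sqrt P * symplecticForm n)
        = (symplecticForm n)ᵀ * CFC.sqrt P * (symplecticForm n * (symplecticForm n)ᵀ) *
          CFC.sqrt P * symplecticForm n := by noncomm_ring
      _ = (symplecticForm n)ᵀ * (CFC.sqrt P * CFC.sqrt P) * symplecticForm n := by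
          rw [symplecticForm_mul_transpose_self]; noncomm_ring
      _ = _ := by rw [hSS]
  have hT : (CFC.sqrt P)ᵀ = CFC.sqrt P := hS.isHermitian
  refine ⟨CFC.sqrt P, (mem_symplecticGroup_iff _).2 ?_, by rw [hT, hSS]⟩
  rw [hT]
  have h1 : CFC.sqrt P * ((symplecticForm n)ᵀ * CFC.sqrt P * symplecticForm n) = 1 := by
    rw [← hconj]
    exact mul_nonsing_inv _ ((isUnit_iff_isUnit_det _).1 hunit)
  calc CFC.sqrt P * symplecticForm n * CFC.sqrt P
      = CFC.sqrt P * ((symplecticForm n)ᵀ * CFC.sqrt P * symplecticForm n) * symplecticForm n := by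
        simp only [symplecticForm_transpose, Matrix.mul_assoc, symplecticForm_mul_self,
          Matrix.neg_mul, Matrix.mul_neg, Matrix.mul_one, neg_neg]
    _ = symplecticForm n := by rw [h1, Matrix.one_mul]

end SymplecticForm

/-! ### Operator convexity of the inverse -/

section HarmonicMean

variable {m : Type*}

theorem posDef_smul_add_smul {X Y : Matrix m m ℝ} (hX : X.PosDef) (hY : Y.PosDef)
    {a b : ℝ} (ha : 0 ≤ a) (hb : 0 ≤ b) (hab : a + b = 1) : (a • X + b • Y).PosDef := by
  rcases ha.eq_or_lt with rfl | ha'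
  · simpa [(zero_add b).symm.trans hab] using hY
  · exact (hX.smul ha').add_posSemidef (hY.posSemidef.smul hb)

/-- The matrix inequality between the harmonic and the arithmetic mean, that is, convexity of the
inverse. -/
theorem posSemidef_smul_inv_add_smul_inv_sub [Fintype m] [DecidableEq m] {X Y : Matrix m m ℝ}
    (hX : X.PosDef) (hY : Y.PosDef) {a b : ℝ} (ha : 0 ≤ a) (hb : 0 ≤ b) (hab : a + b = 1) :
    (a • X⁻¹ + b • Y⁻¹ - (a • X + b • Y)⁻¹).PosSemidef := by
  have hM := posDef_smul_add_smul hX hY ha hb hab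
  set M := a • X + b • Y with hMdef
  have hXi : X * X⁻¹ = 1 := mul_nonsing_inv _ ((isUnit_iff_isUnit_det _).1 hX.isUnit)
  have hXi' : X⁻¹ * X = 1 := nonsing_inv_mul _ ((isUnit_iff_isUnit_det _).1 hX.isUnit)
  have hYi : Y * Y⁻¹ = 1 := mul_nonsing_inv _ ((isUnit_iff_isUnit_det _).1 hY.isUnit)
  have hYi' : Y⁻¹ * Y = 1 := nonsing_inv_mul _ ((isUnit_iff_isUnit_det _).1 hY.isUnit)
  have hMi : M⁻¹ * M = 1 := nonsing_inv_mul _ ((isUnit_iff_isUnit_det _).1 hM.isUnit)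
  have expand (Z : Matrix m m ℝ) (h1 : Z * Z⁻¹ = 1) (h2 : Z⁻¹ * Z = 1) :
      (Z⁻¹ - M⁻¹) * Z * (Z⁻¹ - M⁻¹) = Z⁻¹ - M⁻¹ - M⁻¹ + M⁻¹ * Z * M⁻¹ := by
    rw [sub_mul, sub_mul, h2, mul_sub, mul_sub, Matrix.mul_assoc M⁻¹ Z Z⁻¹, h1]
    simp only [Matrix.one_mul, Matrix.mul_one]
    abel
  have hsum : a • (M⁻¹ * X * M⁻¹) + b • (M⁻¹ * Y * M⁻¹) = M⁻¹ := by
    calc a • (M⁻¹ * X * M⁻¹) + b • (M⁻¹ * Y * M⁻¹) = M⁻¹ * M * M⁻¹ := by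
          rw [hMdef]; simp [Matrix.mul_add, Matrix.add_mul]
      _ = M⁻¹ := by rw [hMi, Matrix.one_mul]
  -- Completing the square about M⁻¹; the weighted mean of the terms M⁻¹ZM⁻¹ over Z = X, Y is M⁻¹.
  have hdecomp : a • X⁻¹ + b • Y⁻¹ - M⁻¹ =
      a • ((X⁻¹ - M⁻¹) * X * (X⁻¹ - M⁻¹)) + b • ((Y⁻¹ - M⁻¹) * Y * (Y⁻¹ - M⁻¹)) := by
    rw [expand X hXi hXi', expand Y hYi hYi']
    have h1 : M⁻¹ = a • M⁻¹ + b • M⁻¹ := by rw [← add_smul, hab, one_smul]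
    calc a • X⁻¹ + b • Y⁻¹ - M⁻¹
        = a • X⁻¹ + b • Y⁻¹ - M⁻¹ - M⁻¹ + M⁻¹ := by abel
      _ = a • X⁻¹ + b • Y⁻¹ - (a • M⁻¹ + b • M⁻¹) - (a • M⁻¹ + b • M⁻¹) +
          (a • (M⁻¹ * X * M⁻¹) + b • (M⁻¹ * Y * M⁻¹)) := by rw [← h1, hsum]
      _ = _ := by simp only [smul_add, smul_sub]; abel
  have herm {Z : Matrix m m ℝ} (hZ : Z.PosDef) : (Z⁻¹ - M⁻¹)ᴴ = Z⁻¹ - M⁻¹ :=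
    hZ.inv.isHermitian.sub hM.inv.isHermitian
  have hconj {Z : Matrix m m ℝ} (hZ : Z.PosDef) :
      ((Z⁻¹ - M⁻¹) * Z * (Z⁻¹ - M⁻¹)).PosSemidef := by
    have := hZ.posSemidef.conjTranspose_mul_mul_same (Z⁻¹ - M⁻¹)
    rwa [herm hZ] at this
  rw [hdecomp]
  exact ((hconj hX).smul ha).add ((hconj hY).smul hb)

end HarmonicMean

/-! ### Linearizing the symplectic condition by P ↦ (P + 1)⁻¹ -/

section CayleyTransform

variable {n : ℕ}

/-- `M = (P + 1)⁻¹` satisfies `J M + M J = J` for a symplectic positive definite `P`. -/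
theorem inv_add_one_mul_symplecticForm {P : Mat n} (hP : P.PosDef)
    (hJ : P * symplecticForm n * P = symplecticForm n) :
    symplecticForm n * (P + 1)⁻¹ + (P + 1)⁻¹ * symplecticForm n = symplecticForm n := by
  have hP1 : (P + 1).PosDef := hP.add_posSemidef PosSemidef.one
  have h1 : (P + 1)⁻¹ * (P + 1) = 1 := nonsing_inv_mul _ ((isUnit_iff_isUnit_det _).1 hP1.isUnit)
  have h2 : (P + 1) * (P + 1)⁻¹ = 1 := mul_nonsing_inv _ ((isUnit_iff_isUnit_det _).1 hP1.isUnit)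
  have h3 : symplecticForm n * (P + 1) = (P + 1) * (symplecticForm n * P) := by
    rw [Matrix.add_mul, ← Matrix.mul_assoc, hJ, Matrix.mul_add, Matrix.mul_one, Matrix.one_mul,
      add_comm]
  have h4 : (P + 1)⁻¹ * symplecticForm n = symplecticForm n * P * (P + 1)⁻¹ := by
    calc (P + 1)⁻¹ * symplecticForm n
        = (P + 1)⁻¹ * (symplecticForm n * (P + 1)) * (P + 1)⁻¹ := by
          rw [Matrix.mul_assoc, Matrix.mul_assoc, h2, Matrix.mul_one]
      _ = (P + 1)⁻¹ * (P + 1) * (symplecticForm n * P) * (P + 1)⁻¹ := by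
          rw [h3]; noncomm_ring
      _ = symplecticForm n * P * (P + 1)⁻¹ := by rw [h1, Matrix.one_mul]
  rw [h4, Matrix.mul_assoc, ← Matrix.mul_add, add_comm]
  calc symplecticForm n * (P * (P + 1)⁻¹ + (P + 1)⁻¹)
      = symplecticForm n * ((P + 1) * (P + 1)⁻¹) := by rw [Matrix.add_mul, Matrix.one_mul]
    _ = symplecticForm n := by rw [h2, Matrix.mul_one]

/-- Conversely, `M⁻¹ - 1` is symplectic when `J M + M J = J`. -/
theorem inv_sub_one_mul_symplecticForm_mul {M : Mat n} (hM : M.PosDef)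
    (hJ : symplecticForm n * M + M * symplecticForm n = symplecticForm n) :
    (M⁻¹ - 1) * symplecticForm n * (M⁻¹ - 1) = symplecticForm n := by
  have h1 : M⁻¹ * M = 1 := nonsing_inv_mul _ ((isUnit_iff_isUnit_det _).1 hM.isUnit)
  have h2 : M * M⁻¹ = 1 := mul_nonsing_inv _ ((isUnit_iff_isUnit_det _).1 hM.isUnit)
  have h3 : (M⁻¹ - 1) * symplecticForm n = M⁻¹ * symplecticForm n * M := by
    calc (M⁻¹ - 1) * symplecticForm n
        = M⁻¹ * symplecticForm n - M⁻¹ * M * symplecticForm n := by rw [h1, Matrix.sub_mul]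
      _ = M⁻¹ * (symplecticForm n * M + M * symplecticForm n) -
          M⁻¹ * M * symplecticForm n := by rw [hJ]
      _ = _ := by noncomm_ring
  calc (M⁻¹ - 1) * symplecticForm n * (M⁻¹ - 1)
      = M⁻¹ * symplecticForm n * (M * M⁻¹) - M⁻¹ * symplecticForm n * M := by
        rw [h3]; noncomm_ring
    _ = M⁻¹ * symplecticForm n - M⁻¹ * symplecticForm n * M := by rw [h2, Matrix.mul_one]
    _ = M⁻¹ * (symplecticForm n * M + M * symplecticForm n) - M⁻¹ * symplecticForm n * M := by
        rw [hJ]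
    _ = M⁻¹ * M * symplecticForm n := by noncomm_ring
    _ = symplecticForm n := by rw [h1, Matrix.one_mul]

/-- The condition on M reads JᵀMJ = 1 - M, so M ≤ 1; then M⁻¹ - 1 = (1 - M) + (1 - M)M⁻¹(1 - M). -/
theorem posSemidef_inv_sub_one {M : Mat n} (hM : M.PosDef)
    (hJ : symplecticForm n * M + M * symplecticForm n = symplecticForm n) :
    (M⁻¹ - 1).PosSemidef := by
  have h1 : M⁻¹ * M = 1 := nonsing_inv_mul _ ((isUnit_iff_isUnit_det _).1 hM.isUnit)
  have h2 : M * M⁻¹ = 1 := mul_nonsing_inv _ ((isUnit_iff_isUnit_det _).1 hM.isUnit)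
  have hsub : (1 - M).PosSemidef := by
    have h := hM.posSemidef.conjTranspose_mul_mul_same (symplecticForm n)
    have : (symplecticForm n)ᴴ * M * symplecticForm n = 1 - M := by
      rw [conjTranspose_eq_transpose_of_trivial, Matrix.mul_assoc, eq_sub_of_add_eq' hJ,
        Matrix.mul_sub, ← Matrix.mul_assoc, symplecticForm_transpose_mul_self, Matrix.one_mul]
    rwa [this] at h
  have hdecomp : M⁻¹ - 1 = (1 - M) + (1 - M)ᴴ * M⁻¹ * (1 - M) := by
    have hrw : (1 - M) * M⁻¹ * (1 - M) = M⁻¹ - M⁻¹ * M - M * M⁻¹ + M * M⁻¹ * M := by noncomm_ring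
    rw [hsub.isHermitian.eq, hrw, h1, h2, Matrix.one_mul]
    abel
  rw [hdecomp]
  exact hsub.add (hM.inv.posSemidef.conjTranspose_mul_mul_same _)

end CayleyTransform

/-! ### A symplectic matrix below each covariance matrix -/

section Williamson

variable {n : ℕ}

theorem transpose_eq_of_mem_covarianceMatrices {Γ : Mat n} (h : Γ ∈ covarianceMatrices n) :
    Γᵀ = Γ := by
  ext i j
  have := congrArg Complex.re (congrFun (congrFun h.isHermitian.eq i) j)
  simpa using this

/-- The real form of Γ ≥ iJ, obtained by testing on z = u - iv; antisymmetry of J merges the cross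
terms. -/
theorem two_mul_symplecticForm_le {Γ : Mat n} (h : Γ ∈ covarianceMatrices n)
    (u v : Fin n ⊕ Fin n → ℝ) :
    2 * (u ⬝ᵥ symplecticForm n *ᵥ v) ≤ u ⬝ᵥ Γ *ᵥ u + v ⬝ᵥ Γ *ᵥ v := by
  have hz := (Complex.le_def.1 (h.dotProduct_mulVec_nonneg fun i => ⟨u i, -v i⟩)).1
  have hre : (star (fun i => (⟨u i, -v i⟩ : ℂ)) ⬝ᵥ (Γ.map Complex.ofReal -
      Complex.I • (symplecticForm n).map Complex.ofReal) *ᵥ fun i => ⟨u i, -v i⟩).re =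
      u ⬝ᵥ Γ *ᵥ u + v ⬝ᵥ Γ *ᵥ v + v ⬝ᵥ symplecticForm n *ᵥ u - u ⬝ᵥ symplecticForm n *ᵥ v := by
    simp only [dotProduct, mulVec, Finset.mul_sum, Complex.re_sum, ← Finset.sum_add_distrib,
      ← Finset.sum_sub_distrib]
    refine Finset.sum_congr rfl fun i _ => Finset.sum_congr rfl fun j _ => ?_
    simp
    ring
  have hanti : v ⬝ᵥ symplecticForm n *ᵥ u = -(u ⬝ᵥ symplecticForm n *ᵥ v) := by
    rw [dotProduct_comm u, ← dotProduct_transpose_mulVec, symplecticForm_transpose, neg_mulVec,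
      dotProduct_neg, dotProduct_comm]
  rw [hre, hanti] at hz
  simp only [Complex.zero_re] at hz
  linarith

theorem posDef_of_mem_covarianceMatrices {Γ : Mat n} (h : Γ ∈ covarianceMatrices n) :
    Γ.PosDef := by
  have hle := two_mul_symplecticForm_le h
  have hpsd : Γ.PosSemidef := by
    refine .of_dotProduct_mulVec_nonneg (transpose_eq_of_mem_covarianceMatrices h) fun x => ?_
    simpa using hle x 0
  rw [hpsd.posDef_iff_isUnit, ← mulVec_injective_iff_isUnit, ← coe_mulVecLin,
    ← LinearMap.ker_eq_bot, LinearMap.ker_eq_bot']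
  intro v hv
  rw [mulVecLin_apply] at hv
  set w := symplecticForm n *ᵥ v with hw
  have hvw : v = -(symplecticForm n *ᵥ w) := by
    rw [hw, mulVec_mulVec, symplecticForm_mul_self, neg_mulVec, one_mulVec,
      neg_neg]
  have hww : w ⬝ᵥ w = 0 := by
    by_contra hne
    have hc : 0 ≤ w ⬝ᵥ Γ *ᵥ w := by simpa using hle w 0
    -- As Γv = 0, scaling v leaves the right side at w·Γw; this factor makes the left side 2(w·Γw +
    -- 1).
    have h1 := hle w (((w ⬝ᵥ Γ *ᵥ w + 1) / (w ⬝ᵥ w)) • v)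
    simp only [mulVec_smul, hv, ← hw, dotProduct_smul, smul_zero, dotProduct_zero,
      smul_eq_mul, add_zero] at h1
    rw [div_mul_cancel₀ _ hne] at h1
    linarith
  rw [hvw, dotProduct_self_eq_zero.1 hww]
  simp

open scoped MatrixOrder in
/-- Every covariance matrix dominates a positive semidefinite symplectic matrix. -/
theorem exists_posSemidef_symplectic_le {Γ : Mat n} (h : Γ ∈ covarianceMatrices n) :
    ∃ P : Mat n, P.PosSemidef ∧ P * symplecticForm n * P = symplecticForm n ∧
      (Γ - P).PosSemidef := by
  have hΓ := posDef_of_mem_covarianceMatrices h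
  set J := symplecticForm n with hJdef
  set Q := CFC.sqrt Γ
  have hQ : Q.PosSemidef := (CFC.sqrt_nonneg Γ).posSemidef
  have hQQ : Q * Q = Γ := CFC.sqrt_mul_sqrt_self Γ hΓ.posSemidef.nonneg
  have hQT : Qᵀ = Q := hQ.isHermitian
  have hQu : IsUnit Q.det := by
    refine (isUnit_iff_isUnit_det _).1 (isUnit_of_mul_isUnit_left (y := Q) ?_)
    rw [hQQ]; exact hΓ.isUnit
  have hQi : Q * Q⁻¹ = 1 := mul_nonsing_inv _ hQu
  have hQi' : Q⁻¹ * Q = 1 := nonsing_inv_mul _ hQu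
  have hQiT : (Q⁻¹)ᵀ = Q⁻¹ := by rw [transpose_nonsing_inv, hQT]
  -- With C = -B⁻¹, symplecticity of QRQ amounts to RCR = B, solved by R = |B|.
  set B := Q⁻¹ * J * Q⁻¹ with hB
  set C := Q * J * Q with hC
  have hBT : Bᵀ = -B := by
    rw [hB, transpose_mul, transpose_mul, hQiT, hJdef, symplecticForm_transpose]
    noncomm_ring
  have hBC : B * C = -1 := by
    calc B * C = Q⁻¹ * J * (Q⁻¹ * Q) * J * Q := by rw [hB, hC]; noncomm_ring
      _ = Q⁻¹ * (J * J) * Q := by rw [hQi']; noncomm_ring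
      _ = -(Q⁻¹ * Q) := by rw [hJdef, symplecticForm_mul_self]; noncomm_ring
      _ = -1 := by rw [hQi']
  have hCB : C * B = -1 := by
    calc C * B = Q * J * (Q * Q⁻¹) * J * Q⁻¹ := by rw [hB, hC]; noncomm_ring
      _ = Q * (J * J) * Q⁻¹ := by rw [hQi]; noncomm_ring
      _ = -(Q * Q⁻¹) := by rw [hJdef, symplecticForm_mul_self]; noncomm_ring
      _ = -1 := by rw [hQi]
  have hBB : (Bᵀ * B).PosSemidef := posSemidef_conjTranspose_mul_self B
  set R := CFC.sqrt (Bᵀ * B)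
  have hR : R.PosSemidef := (CFC.sqrt_nonneg _).posSemidef
  have hRR : R * R = Bᵀ * B := CFC.sqrt_mul_sqrt_self _ hBB.nonneg
  have hRB : Commute R B := by
    have hcomm : Commute (Bᵀ * B) B := by
      rw [hBT, Commute, SemiconjBy]; noncomm_ring
    rw [show R = _ from CFC.sqrt_eq_cfc]
    exact hcomm.cfc_nnreal _
  have hRCR : R * C * R = B := by
    have hRC : R * C = C * R := by
      calc R * C = -(C * B) * (R * C) := by rw [hCB]; simp
        _ = -(C * (B * R) * C) := by noncomm_ring
        _ = -(C * R * (B * C)) := by rw [← hRB.eq]; noncomm_ring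
        _ = C * R := by rw [hBC]; simp
    calc R * C * R = C * (R * R) := by rw [hRC, Matrix.mul_assoc]
      _ = -(C * B) * B := by rw [hRR, hBT]; noncomm_ring
      _ = B := by rw [hCB]; simp
  have hBle : (1 - Bᵀ * B).PosSemidef := by
    refine .of_dotProduct_mulVec_nonneg (isHermitian_one.sub hBB.isHermitian) fun y => ?_
    -- These test vectors give 2|By|² ≤ |By|² + |y|², so B is a contraction.
    have key := two_mul_symplecticForm_le h (Q⁻¹ *ᵥ (B *ᵥ y)) (Q⁻¹ *ᵥ y)
    have hmove (x z : Fin n ⊕ Fin n → ℝ) (A : Mat n) :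
        (Q⁻¹ *ᵥ x) ⬝ᵥ A *ᵥ (Q⁻¹ *ᵥ z) = x ⬝ᵥ (Q⁻¹ * A * Q⁻¹) *ᵥ z := by
      rw [dotProduct_comm, ← dotProduct_transpose_mulVec, hQiT, mulVec_mulVec, mulVec_mulVec]
    have hone : Q⁻¹ * Γ * Q⁻¹ = 1 := by
      calc Q⁻¹ * Γ * Q⁻¹ = (Q⁻¹ * Q) * (Q * Q⁻¹) := by rw [← hQQ]; noncomm_ring
        _ = 1 := by rw [hQi, hQi', Matrix.one_mul]
    rw [hmove, hmove, hmove, hone, ← hJdef, ← hB, one_mulVec, one_mulVec] at key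
    have hyy : y ⬝ᵥ (Bᵀ * B) *ᵥ y = B *ᵥ y ⬝ᵥ B *ᵥ y := by
      rw [← mulVec_mulVec, dotProduct_transpose_mulVec]
    rw [star_trivial, sub_mulVec, one_mulVec, dotProduct_sub, hyy]
    linarith
  have hRle : (1 - R).PosSemidef := by
    -- This passes from R² ≤ 1 to R ≤ 1 without diagonalizing R.
    have h1 : (1 - R)ᴴ * (1 - R) + (1 - R * R) = (2 : ℝ) • (1 - R) := by
      rw [(isHermitian_one.sub hR.isHermitian).eq, two_smul]
      noncomm_ring
    have h2 := ((posSemidef_conjTranspose_mul_self (1 - R)).add (hRR ▸ hBle)).smul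
      (by norm_num : (0 : ℝ) ≤ 2⁻¹)
    rwa [h1, smul_smul, inv_mul_cancel₀ two_ne_zero, one_smul] at h2
  have hconj {Z : Mat n} (hZ : Z.PosSemidef) : (Q * Z * Q).PosSemidef := by
    have := hZ.conjTranspose_mul_mul_same Q
    rwa [hQ.isHermitian.eq] at this
  refine ⟨Q * R * Q, hconj hR, ?_, ?_⟩
  · calc Q * R * Q * J * (Q * R * Q) = Q * (R * C * R) * Q := by rw [hC]; noncomm_ring
      _ = (Q * Q⁻¹) * J * (Q⁻¹ * Q) := by rw [hRCR, hB]; noncomm_ring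
      _ = J := by rw [hQi, hQi', Matrix.one_mul, Matrix.mul_one]
  · have := hconj hRle
    rwa [Matrix.mul_sub, Matrix.sub_mul, Matrix.mul_one, hQQ] at this

end Williamson

/-! ### F as a spectral sum -/

section SingularValues

variable {n : ℕ}

theorem toEuclideanLin_mul_apply (A B : Mat n) (x : EuclideanSpace ℝ (Fin n ⊕ Fin n)) :
    (A * B).toEuclideanLin x = A.toEuclideanLin (B.toEuclideanLin x) := by
  ext i
  simp [toLpLin_apply]

theorem toEuclideanLin_one_apply (x : EuclideanSpace ℝ (Fin n ⊕ Fin n)) :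
    (1 : Mat n).toEuclideanLin x = x := by
  ext i
  simp

/-- The orthogonal operator given by the symplectic form. -/
noncomputable def symplecticIsometry (n : ℕ) :
    EuclideanSpace ℝ (Fin n ⊕ Fin n) ≃ₗᵢ[ℝ] EuclideanSpace ℝ (Fin n ⊕ Fin n) :=
  LinearIsometry.toLinearIsometryEquiv
    ((symplecticForm n).toEuclideanLin.isometryOfInner fun x y => by
      rw [← LinearMap.adjoint_inner_right, ← toEuclideanLin_conjTranspose_eq_adjoint,
        conjTranspose_eq_transpose_of_trivial, ← toEuclideanLin_mul_apply,
        symplecticForm_transpose_mul_self, toEuclideanLin_one_apply]) rfl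

theorem symplecticIsometry_apply (x : EuclideanSpace ℝ (Fin n ⊕ Fin n)) :
    symplecticIsometry n x = (symplecticForm n).toEuclideanLin x := rfl

/-- `F(S)` in terms of an orthonormal eigenbasis of `SᵀS`. -/
theorem exists_eigenbasis_F_eq {S : Mat n} (hS : S ∈ symplecticGroup (Fin n) ℝ) :
    ∃ (b : OrthonormalBasis (Fin (n + n)) ℝ (EuclideanSpace ℝ (Fin n ⊕ Fin n)))
      (l : Fin (n + n) → ℝ), (∀ i, 0 < l i) ∧
      (∀ i, (Sᵀ * S).toEuclideanLin (b i) = l i • b i) ∧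
      F S = 4⁻¹ * ∑ i, |Real.log (l i)| := by
  have hcard : Module.finrank ℝ (EuclideanSpace ℝ (Fin n ⊕ Fin n)) = n + n := by simp
  set T := S.toEuclideanLin with hT
  have hadj : (Sᵀ * S).toEuclideanLin = T.adjoint ∘ₗ T := by
    ext1 x
    rw [toEuclideanLin_mul_apply, LinearMap.comp_apply, hT,
      ← toEuclideanLin_conjTranspose_eq_adjoint, conjTranspose_eq_transpose_of_trivial]
  have hsymm := T.isSymmetric_adjoint_comp_self
  set b := hsymm.eigenvectorBasis hcard
  set l := hsymm.eigenvalues hcard with hl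
  have hb (i) : (Sᵀ * S).toEuclideanLin (b i) = l i • b i := by
    rw [hadj]
    exact hsymm.apply_eigenvectorBasis hcard i
  have hP := posDef_transpose_mul_self hS
  have hJ := transpose_mul_self_mul_symplecticForm_mul hS
  have hpos (i) : 0 < l i := by
    have h1 : 0 ≤ l i := T.isPositive_adjoint_comp_self.nonneg_eigenvalues hcard i
    refine lt_of_le_of_ne h1 fun h0 => ?_
    have h2 := hb i
    rw [← h0, zero_smul] at h2
    have h3 : (Sᵀ * S)⁻¹.toEuclideanLin ((Sᵀ * S).toEuclideanLin (b i)) = b i := by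
      rw [← toEuclideanLin_mul_apply,
        nonsing_inv_mul _ ((isUnit_iff_isUnit_det _).1 hP.isUnit), toEuclideanLin_one_apply]
    rw [h2, map_zero] at h3
    exact b.orthonormal.ne_zero i h3.symm
  -- From PJP = J, the isometry J carries an eigenvector for l to one for l⁻¹. Comparing the two
  -- eigenbases gives the inversion invariance.
  have hb' (i) : (Sᵀ * S).toEuclideanLin (b.map (symplecticIsometry n) i) =
      (l i)⁻¹ • b.map (symplecticIsometry n) i := by
    rw [OrthonormalBasis.map_apply, symplecticIsometry_apply]
    have h1 : (symplecticForm n).toEuclideanLin (b i) =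
        l i • (Sᵀ * S).toEuclideanLin ((symplecticForm n).toEuclideanLin (b i)) := by
      conv_lhs => rw [← hJ, toEuclideanLin_mul_apply, toEuclideanLin_mul_apply, hb, map_smul,
        map_smul]
    conv_rhs => rw [h1, smul_smul, inv_mul_cancel₀ (hpos i).ne', one_smul]
  refine ⟨b, l, hpos, hb, ?_⟩
  have hsum := sum_log_castAdd_eq (hsymm.eigenvalues_antitone hcard) hpos fun φ =>
    sum_eigenvalues_eq b _ hb hb' φ
  -- One factor 1/2 comes from sᵢ = √lᵢ, the other from `sum_log_castAdd_eq`; hence the 4⁻¹.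
  have hF : F S = ∑ i : Fin n, 2⁻¹ * Real.log (l (Fin.castAdd n i)) := by
    rw [F, Finset.sum_range]
    refine Finset.sum_congr rfl fun i _ => ?_
    have := T.singularValues_fin hcard (Fin.castAdd n i)
    rw [Fin.val_castAdd] at this
    rw [this, Real.log_sqrt (hpos _).le]
    ring
  rw [hF, ← Finset.mul_sum, hsum]
  ring

theorem F_nonneg {S : Mat n} (hS : S ∈ symplecticGroup (Fin n) ℝ) : 0 ≤ F S := by
  obtain ⟨b, l, -, -, h⟩ := exists_eigenbasis_F_eq hS
  rw [h]
  positivity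

/-- `F(S)` in terms of an orthonormal eigenbasis of `(SᵀS + 1)⁻¹`. -/
theorem exists_eigenbasis_inv_F_eq {S : Mat n} (hS : S ∈ symplecticGroup (Fin n) ℝ) :
    ∃ (b : OrthonormalBasis (Fin (n + n)) ℝ (EuclideanSpace ℝ (Fin n ⊕ Fin n)))
      (x : Fin (n + n) → ℝ), (∀ i, x i ∈ Set.Ioo (0 : ℝ) 1) ∧
      (∀ i, (Sᵀ * S + 1)⁻¹.toEuclideanLin (b i) = x i • b i) ∧
      F S = 4⁻¹ * ∑ i, |Real.log (1 - x i) - Real.log (x i)| := by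
  obtain ⟨b, l, hpos, hb, hF⟩ := exists_eigenbasis_F_eq hS
  refine ⟨b, fun i => (l i + 1)⁻¹, fun i => inv_add_one_mem_Ioo (hpos i), fun i => ?_, ?_⟩
  · have hP : (Sᵀ * S + 1).PosDef := (posDef_transpose_mul_self hS).add_posSemidef PosSemidef.one
    have h1 : (Sᵀ * S + 1).toEuclideanLin (b i) = (l i + 1) • b i := by
      rw [map_add, LinearMap.add_apply, hb, toEuclideanLin_one_apply, add_smul, one_smul]
    have h2 : (Sᵀ * S + 1)⁻¹.toEuclideanLin ((Sᵀ * S + 1).toEuclideanLin (b i)) = b i := by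
      rw [← toEuclideanLin_mul_apply,
        nonsing_inv_mul _ ((isUnit_iff_isUnit_det _).1 hP.isUnit), toEuclideanLin_one_apply]
    have h3 : l i + 1 ≠ 0 := by linarith [hpos i]
    rw [h1, map_smul] at h2
    conv_rhs => rw [← h2, smul_smul, inv_mul_cancel₀ h3, one_smul]
  · rw [hF]
    simp_rw [abs_log_sub_log_inv_add_one (hpos _)]

end SingularValues

/-! ### Finiteness and convexity of G -/

section Main

variable {n : ℕ}

theorem costs_nonempty {Γ : Mat n} (h : Γ ∈ covarianceMatrices n) : (costs Γ).Nonempty := by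
  obtain ⟨P, hP, hJ, hle⟩ := exists_posSemidef_symplectic_le h
  obtain ⟨S, hS, rfl⟩ := exists_symplectic_transpose_mul_self hP hJ
  exact ⟨F S, S, hS, hle, rfl⟩

theorem costs_bddBelow (Γ : Mat n) : BddBelow (costs Γ) := by
  refine ⟨0, ?_⟩
  rintro _ ⟨S, hS, -, rfl⟩
  exact F_nonneg hS

theorem convex_covarianceMatrices : Convex ℝ (covarianceMatrices n) := by
  intro Γ hΓ Γ' hΓ' a b ha hb hab
  have h := (PosSemidef.smul hΓ ha).add (PosSemidef.smul hΓ' hb)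
  have e : (a • Γ + b • Γ').map Complex.ofReal - Complex.I • (symplecticForm n).map Complex.ofReal
      = a • (Γ.map Complex.ofReal - Complex.I • (symplecticForm n).map Complex.ofReal) +
        b • (Γ'.map Complex.ofReal - Complex.I • (symplecticForm n).map Complex.ofReal) := by
    ext i j
    have hab' : (a : ℂ) + b = 1 := by exact_mod_cast hab
    simp
    linear_combination Complex.I * (symplecticForm n i j : ℂ) * hab'
  rw [← e] at h
  exact h

/-- The Cayley mean of two symplectic matrices below `Γ` and `Γ'` has cost at most the mean of
the costs. -/
theorem exists_mem_costs_le {Γ Γ' : Mat n} {x y a b : ℝ} (hx : x ∈ costs Γ) (hy : y ∈ costs Γ')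
    (ha : 0 ≤ a) (hb : 0 ≤ b) (hab : a + b = 1) :
    ∃ z ∈ costs (a • Γ + b • Γ'), z ≤ a * x + b * y := by
  obtain ⟨S, hS, hle, rfl⟩ := hx
  obtain ⟨S', hS', hle', rfl⟩ := hy
  have hP := posDef_transpose_mul_self hS
  have hP' := posDef_transpose_mul_self hS'
  have hJ := inv_add_one_mul_symplecticForm hP (transpose_mul_self_mul_symplecticForm_mul hS)
  have hJ' := inv_add_one_mul_symplecticForm hP' (transpose_mul_self_mul_symplecticForm_mul hS')
  have hX : (Sᵀ * S + 1).PosDef := hP.add_posSemidef PosSemidef.one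
  have hX' : (S'ᵀ * S' + 1).PosDef := hP'.add_posSemidef PosSemidef.one
  set X := (Sᵀ * S + 1)⁻¹ with hXdef
  set X' := (S'ᵀ * S' + 1)⁻¹ with hX'def
  have hXi : X⁻¹ = Sᵀ * S + 1 := nonsing_inv_nonsing_inv _ ((isUnit_iff_isUnit_det _).1 hX.isUnit)
  have hXi' : X'⁻¹ = S'ᵀ * S' + 1 :=
    nonsing_inv_nonsing_inv _ ((isUnit_iff_isUnit_det _).1 hX'.isUnit)
  have hM : (a • X + b • X').PosDef := posDef_smul_add_smul hX.inv hX'.inv ha hb hab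
  have hmean := posSemidef_smul_inv_add_smul_inv_sub hX.inv hX'.inv ha hb hab
  set M := a • X + b • X' with hMdef
  have hMJ : symplecticForm n * M + M * symplecticForm n = symplecticForm n := by
    calc symplecticForm n * M + M * symplecticForm n
        = a • (symplecticForm n * X + X * symplecticForm n) +
          b • (symplecticForm n * X' + X' * symplecticForm n) := by
          rw [hMdef]
          simp only [Matrix.mul_add, Matrix.add_mul, Matrix.mul_smul, Matrix.smul_mul, smul_add]
          abel
      _ = symplecticForm n := by rw [hJ, hJ', ← add_smul, hab, one_smul]
  obtain ⟨T, hT, hTM⟩ := exists_symplectic_transpose_mul_self (posSemidef_inv_sub_one hM hMJ)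
    (inv_sub_one_mul_symplecticForm_mul hM hMJ)
  have hTM' : (Tᵀ * T + 1)⁻¹ = M := by
    rw [hTM, sub_add_cancel]
    exact nonsing_inv_nonsing_inv _ ((isUnit_iff_isUnit_det _).1 hM.isUnit)
  refine ⟨F T, ⟨T, hT, ?_, rfl⟩, ?_⟩
  · have h := ((hle.smul ha).add (hle'.smul hb)).add hmean
    -- The slack splits into the averaged slacks of S and S' plus the gap from operator convexity;
    -- the identity terms cancel because a + b = 1.
    have e : a • Γ + b • Γ' - Tᵀ * T =
        a • (Γ - Sᵀ * S) + b • (Γ' - S'ᵀ * S') + (a • X⁻¹ + b • X'⁻¹ - M⁻¹) := by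
      have h1 : (1 : Mat n) = a • 1 + b • 1 := by rw [← add_smul, hab, one_smul]
      rw [hTM, hXi, hXi']
      nth_rewrite 1 [h1]
      simp only [smul_add, smul_sub]
      abel
    rwa [e]
  · obtain ⟨u, m, -, hu, hF⟩ := exists_eigenbasis_inv_F_eq hT
    obtain ⟨v, p, hp, hv, hF₁⟩ := exists_eigenbasis_inv_F_eq hS
    obtain ⟨w, q, hq, hw, hF₂⟩ := exists_eigenbasis_inv_F_eq hS'
    rw [hTM', hMdef, map_add, map_smul, map_smul] at hu
    have := sum_convexOn_eigenvalues_le v w u hv hw hu ha hb hab convexOn_abs_log_sub_log hp hq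
    rw [hF, hF₁, hF₂]
    linarith

end Main

end Squeezing

theorem mainTheorem4 (n : ℕ) :
    (∀ Γ ∈ Squeezing.covarianceMatrices n,
      IsGLB (Squeezing.costs Γ) (Squeezing.G Γ)) ∧
    ConvexOn ℝ (Squeezing.covarianceMatrices n) (Squeezing.G : Squeezing.Mat n → ℝ) := by
  refine ⟨fun Γ hΓ => isGLB_csInf (Squeezing.costs_nonempty hΓ) (Squeezing.costs_bddBelow Γ),
    Squeezing.convex_covarianceMatrices, fun Γ hΓ Γ' hΓ' a b ha hb hab => ?_⟩
  -- Near-minimizers suffice, so attainment of the infima is not needed.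
  refine le_of_forall_pos_le_add fun ε hε => ?_
  obtain ⟨x, hx, hxε⟩ := Real.lt_sInf_add_pos (Squeezing.costs_nonempty hΓ) hε
  obtain ⟨y, hy, hyε⟩ := Real.lt_sInf_add_pos (Squeezing.costs_nonempty hΓ') hε
  obtain ⟨z, hz, hzle⟩ := Squeezing.exists_mem_costs_le hx hy ha hb hab
  calc Squeezing.G (a • Γ + b • Γ') ≤ z := csInf_le (Squeezing.costs_bddBelow _) hz
    _ ≤ a * x + b * y := hzle
    _ ≤ a * (Squeezing.G Γ + ε) + b * (Squeezing.G Γ' + ε) :=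
        add_le_add (mul_le_mul_of_nonneg_left hxε.le ha) (mul_le_mul_of_nonneg_left hyε.le hb)
    _ = a • Squeezing.G Γ + b • Squeezing.G Γ' + ε := by
        simp only [smul_eq_mul]; linear_combination ε * hab
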